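/- Rings are associative but not necessarily unital. An involution on a ring $A$ is an additive map $x\mapsto x^*$ with $(xy)^*=y^*x^*$ and $(x^*)^*=x$. An element of $A$ is positive, written $x\ge 0$, if it is a finite sum of elements $yy^*$ with $y\in A$; we write $x>0$ if $x\geq 0$ and $x\neq 0$. The ring $A$ is positive definite if $\sum_{i=1}^n x_ix_i^*=0$ implies $x_1=\dots=x_n=0$. Let $E=(E^0,E^1,\mathbf{s},\mathbf{r})$ be an arbitrary directed graph and $K$ a field with an involution. The Leavitt path algebra $L_K(E)$ is the $K$-algebra generated by $E^0\cup E^1\cup\{e^*\mid e\in E^1\}$ subject to the relations, for all vertices $v,w$ and edges $e,f$: $vw=\delta_{v,w}v$; $\mathbf{s}(e)e=e\,\mathbf{r}(e)=e$; $\mathbf{r}(e)e^*=e^*\mathbf{s}(e)=e^*$; $e^*f=\delta_{e,f}\mathbf{r}(e)$; and $v=\sum_{e\in\mathbf{s}^{-1}(v)}ee^*$ whenever $\mathbf{s}^{-1}(v)$ is finite and nonempty. It carries the involution extending that of $K$ (so that $(ax)^*=a^*x^*$ for $a\in K$), fixing each vertex and exchanging $e$ and $e^*$. Paths are finite composable sequences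 of edges $p=e_1\cdots e_n$, with $\mathbf{r}(p)=\mathbf{r}(e_n)$ and $p^*=e_n^*\cdots e_1^*$; vertices are the paths of length zero, with $\mathbf{r}(v)=v=v^*$. Theorem. Let $R$ be a positive definite involutive $K$-algebra (with $(ax)^*=a^*x^*$ for $a\in K$, $x\in R$), and let $t:L_K(E)\to R$ be a $K$-linear map such that $t(xy)=t(yx)$ for all $x,y\in L_K(E)$ (a $K$-linear trace) and $t(pq^*)=\delta_{p,q}\,t(\mathbf{r}(p))$ for all paths $p,q$ (that is, $t$ is canonical). Then $t$ is faithful, i.e. $t(x)>0$ for all $x\in L_K(E)$ with $x>0$, if and only if both of the following conditions hold: (P) $t\big(v-\sum_{e\in I}\mathbf{r}(e)\big)\geq 0$ for all vertices $v$ and all finite subsets $I$ of $\mathbf{s}^{-1}(v)$; (F) $t(v)>0$ for all vertices $v$. -/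

import Mathlib

universe u v w z

/-! ## Involutive rings: positive elements, positive definite involutions, faithful maps

Rings are associative and not necessarily unital; involutions are Mathlib's `StarRing`. -/

section Involutive

/-- `x` is positive: a finite sum of elements of the form `y y*`. -/
def IsPos {A : Type*} [NonUnitalRing A] [StarRing A] (x : A) : Prop :=
  ∃ (n : ℕ) (y : Fin n → A), x = ∑ i, y i * star (y i)

/-- `x > 0`: `x` is positive and nonzero. -/
def IsStrictlyPos {A : Type*} [NonUnitalRing A] [StarRing A] (x : A) : Prop :=
  IsPos x ∧ x ≠ 0

/-- The involution of `A` is positive definite: `∑ xᵢ xᵢ* = 0` forces every `xᵢ` to vanish. -/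
def IsPosDefStarRing (A : Type*) [NonUnitalRing A] [StarRing A] : Prop :=
  ∀ (n : ℕ) (x : Fin n → A), ∑ i, x i * star (x i) = 0 → ∀ i, x i = 0

/-- A map `t` between `*`-rings is faithful if `t x > 0` whenever `x > 0`. -/
def IsFaithfulMap {A B : Type*} [NonUnitalRing A] [StarRing A] [NonUnitalRing B] [StarRing B]
    (t : A → B) : Prop :=
  ∀ x : A, IsStrictlyPos x → IsStrictlyPos (t x)

/-- A map is central if `t (x y) = t (y x)`; an additive central map is a trace. -/
def IsCentralMap {A B : Type*} [Mul A] (t : A → B) : Prop :=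
  ∀ x y : A, t (x * y) = t (y * x)

end Involutive

/-! ## Directed graphs and paths -/

/-- A directed graph with vertex set `V` and edge set `D` (loops, multiple edges, infinite graphs
and infinite emitters are allowed). -/
structure DirGraph (V : Type u) (D : Type v) where
  source : D → V
  range : D → V

namespace DirGraph

variable {V : Type u} {D : Type v}

/-- The edges of the list are composable and the first one (if any) starts at the vertex. -/
def IsPathFrom (E : DirGraph V D) : V → List D → Prop
  | _, [] => True
  | a, e :: l => E.source e = a ∧ E.IsPathFrom (E.range e) l

/-- The final vertex of a list of edges that starts at the given vertex. -/
def endpoint (E : DirGraph V D) : V → List D → V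
  | a, [] => a
  | _, e :: l => E.endpoint (E.range e) l

/-- A path: a source vertex and a finite composable list of edges; the vertices are the paths of
length zero. -/
@[ext]
structure Path (E : DirGraph V D) where
  source : V
  edges : List D
  isPath : E.IsPathFrom source edges

/-- The range of a path. -/
def Path.range {E : DirGraph V D} (p : E.Path) : V :=
  E.endpoint p.source p.edges

/-- `s⁻¹(a)`, the set of edges emitted by `a`. -/
def emitted (E : DirGraph V D) (a : V) : Set D :=
  {e | E.source e = a}

end DirGraph

/-! ## The Leavitt path algebra -/

/-- The generators `E⁰ ∪ E¹ ∪ {e* | e ∈ E¹}`. -/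
inductive LeavittGen (V : Type u) (D : Type v) : Type (max u v)
  | vertex : V → LeavittGen V D
  | edge : D → LeavittGen V D
  | ghost : D → LeavittGen V D

/-- The free (associative, non-unital) `K`-algebra on the generators. -/
abbrev FreeLeavitt (K : Type w) [Field K] (V : Type u) (D : Type v) : Type (max u v w) :=
  MonoidAlgebra K (FreeSemigroup (LeavittGen V D))

namespace FreeLeavitt

variable (K : Type w) [Field K] {V : Type u} {D : Type v}

/-- A generator, as an element of the free algebra. -/
noncomputable def gen (g : LeavittGen V D) : FreeLeavitt K V D :=
  MonoidAlgebra.single (FreeSemigroup.of g) 1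

/-- The congruence defining the Leavitt path algebra: the smallest congruence of the free
`K`-algebra that contains the relations (V), (E1), (E2), (CK1) and (CK2). -/
inductive Rel (E : DirGraph V D) : FreeLeavitt K V D → FreeLeavitt K V D → Prop
  | vertex_mul_self (a : V) : Rel E (gen K (.vertex a) * gen K (.vertex a)) (gen K (.vertex a))
  | vertex_mul_of_ne (a b : V) : a ≠ b → Rel E (gen K (.vertex a) * gen K (.vertex b)) 0
  | source_mul_edge (e : D) :
      Rel E (gen K (.vertex (E.source e)) * gen K (.edge e)) (gen K (.edge e))
  | edge_mul_range (e : D) :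
      Rel E (gen K (.edge e) * gen K (.vertex (E.range e))) (gen K (.edge e))
  | range_mul_ghost (e : D) :
      Rel E (gen K (.vertex (E.range e)) * gen K (.ghost e)) (gen K (.ghost e))
  | ghost_mul_source (e : D) :
      Rel E (gen K (.ghost e) * gen K (.vertex (E.source e))) (gen K (.ghost e))
  | ghost_mul_edge_self (e : D) :
      Rel E (gen K (.ghost e) * gen K (.edge e)) (gen K (.vertex (E.range e)))
  | ghost_mul_edge_of_ne (e f : D) : e ≠ f → Rel E (gen K (.ghost e) * gen K (.edge f)) 0
  | regular (a : V) (hfin : (E.emitted a).Finite) : (E.emitted a).Nonempty →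
      Rel E (gen K (.vertex a)) (∑ e ∈ hfin.toFinset, gen K (.edge e) * gen K (.ghost e))
  | refl (x) : Rel E x x
  | symm {x y} : Rel E x y → Rel E y x
  | trans {x y z} : Rel E x y → Rel E y z → Rel E x z
  | add {x y x' y'} : Rel E x y → Rel E x' y' → Rel E (x + x') (y + y')
  | mul {x y x' y'} : Rel E x y → Rel E x' y' → Rel E (x * x') (y * y')
  | smul (c : K) {x y} : Rel E x y → Rel E (c • x) (c • y)

/-- The congruence, as a bundled ring congruence. -/
def ringCon (E : DirGraph V D) : RingCon (FreeLeavitt K V D) where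
  r := Rel K E
  iseqv := ⟨Rel.refl, Rel.symm, Rel.trans⟩
  add' := Rel.add
  mul' := Rel.mul

end FreeLeavitt

/-! ### The involution of the free algebra -/

/-- The involution on generators: it fixes the vertices and exchanges `e` and `e*`. -/
def LeavittGen.inv {V : Type u} {D : Type v} : LeavittGen V D → LeavittGen V D
  | .vertex a => .vertex a
  | .edge e => .ghost e
  | .ghost e => .edge e

/-- Reverse a word and apply the involution to each letter. -/
def LeavittGen.wordInv {V : Type u} {D : Type v} (x : FreeSemigroup (LeavittGen V D)) :
    FreeSemigroup (LeavittGen V D) :=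
  MulOpposite.unop
    (FreeSemigroup.lift (fun g => MulOpposite.op (FreeSemigroup.of (LeavittGen.inv g))) x)

namespace LeavittGen

variable {V : Type u} {D : Type v}

theorem wordInv_of (g : LeavittGen V D) :
    wordInv (FreeSemigroup.of g) = FreeSemigroup.of (inv g) := rfl

theorem wordInv_mul (x y : FreeSemigroup (LeavittGen V D)) :
    wordInv (x * y) = wordInv y * wordInv x := by
  simp [wordInv]

theorem inv_inv (g : LeavittGen V D) : inv (inv g) = g := by
  cases g <;> rfl

theorem wordInv_wordInv (x : FreeSemigroup (LeavittGen V D)) : wordInv (wordInv x) = x := by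
  induction x using FreeSemigroup.recOnMul with
  | ih1 g => rw [wordInv_of, wordInv_of, inv_inv]
  | ih2 g y hg hy => rw [wordInv_mul, wordInv_mul, hg, hy]

end LeavittGen

namespace FreeLeavitt

variable (K : Type w) [Field K] [StarRing K] {V : Type u} {D : Type v}

/-- The conjugate-linear anti-automorphism `a • x ↦ a* • x*` (`x` a word) of the free algebra. -/
noncomputable def freeStar : FreeLeavitt K V D →+ FreeLeavitt K V D :=
  (Finsupp.liftAddHom fun x =>
      (MonoidAlgebra.singleAddHom (LeavittGen.wordInv x)).comp
        (starAddEquiv : K ≃+ K).toAddMonoidHom).comp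
    MonoidAlgebra.coeffAddEquiv.toAddMonoidHom

variable {K}

theorem freeStar_single (x : FreeSemigroup (LeavittGen V D)) (a : K) :
    freeStar K (MonoidAlgebra.single x a) =
      MonoidAlgebra.single (LeavittGen.wordInv x) (star a) := by
  simp [freeStar, MonoidAlgebra.singleAddHom]

theorem freeStar_gen (g : LeavittGen V D) :
    freeStar K (gen K g) = gen K (LeavittGen.inv g) := by
  rw [gen, freeStar_single, LeavittGen.wordInv_of, star_one, gen]

theorem freeStar_freeStar (x : FreeLeavitt K V D) : freeStar K (freeStar K x) = x := by
  induction x using MonoidAlgebra.induction_linear with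
  | zero => simp
  | add f g hf hg => rw [map_add, map_add, hf, hg]
  | single m r => rw [freeStar_single, freeStar_single, LeavittGen.wordInv_wordInv, star_star]

theorem freeStar_smul (c : K) (x : FreeLeavitt K V D) :
    freeStar K (c • x) = star c • freeStar K x := by
  induction x using MonoidAlgebra.induction_linear with
  | zero => simp
  | add f g hf hg => rw [smul_add, map_add, hf, hg, map_add, smul_add]
  | single m r =>
    simp only [MonoidAlgebra.smul_single, freeStar_single, smul_eq_mul, star_mul']

theorem freeStar_mul (x y : FreeLeavitt K V D) :
    freeStar K (x * y) = freeStar K y * freeStar K x := by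
  induction x using MonoidAlgebra.induction_linear with
  | zero => simp
  | add f g hf hg => rw [add_mul, map_add, hf, hg, map_add, mul_add]
  | single m r =>
    induction y using MonoidAlgebra.induction_linear with
    | zero => simp
    | add f g hf hg => rw [mul_add, map_add, hf, hg, map_add, add_mul]
    | single n s =>
      simp only [MonoidAlgebra.single_mul_single, freeStar_single, LeavittGen.wordInv_mul,
        star_mul]

theorem Rel.freeStar {E : DirGraph V D} {x y : FreeLeavitt K V D} (h : Rel K E x y) :
    Rel K E (FreeLeavitt.freeStar K x) (FreeLeavitt.freeStar K y) := by
  induction h with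
  | vertex_mul_self a =>
    simp only [freeStar_mul, freeStar_gen]; exact .vertex_mul_self a
  | vertex_mul_of_ne a b hab =>
    simp only [freeStar_mul, freeStar_gen, map_zero]; exact .vertex_mul_of_ne b a hab.symm
  | source_mul_edge e =>
    simp only [freeStar_mul, freeStar_gen]; exact .ghost_mul_source e
  | edge_mul_range e =>
    simp only [freeStar_mul, freeStar_gen]; exact .range_mul_ghost e
  | range_mul_ghost e =>
    simp only [freeStar_mul, freeStar_gen]; exact .edge_mul_range e
  | ghost_mul_source e =>
    simp only [freeStar_mul, freeStar_gen]; exact .source_mul_edge e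
  | ghost_mul_edge_self e =>
    simp only [freeStar_mul, freeStar_gen]; exact .ghost_mul_edge_self e
  | ghost_mul_edge_of_ne e f hef =>
    simp only [freeStar_mul, freeStar_gen, map_zero]; exact .ghost_mul_edge_of_ne f e hef.symm
  | regular a hfin hne =>
    simp only [map_sum, freeStar_mul, freeStar_gen]; exact .regular a hfin hne
  | refl x => exact .refl _
  | symm _ ih => exact ih.symm
  | trans _ _ ih₁ ih₂ => exact ih₁.trans ih₂
  | add _ _ ih₁ ih₂ => rw [map_add, map_add]; exact ih₁.add ih₂
  | mul _ _ ih₁ ih₂ => rw [freeStar_mul, freeStar_mul]; exact ih₂.mul ih₁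
  | smul c _ ih => rw [freeStar_smul, freeStar_smul]; exact ih.smul (star c)

end FreeLeavitt

/-! ### The algebra itself -/

/-- The Leavitt path algebra `L_K(E)`: the `K`-algebra with generators `E⁰ ∪ E¹ ∪ (E¹)*` subject
to the relations (V), (E1), (E2), (CK1) and (CK2). -/
def LeavittPathAlgebra (K : Type w) [Field K] {V : Type u} {D : Type v} (E : DirGraph V D) :
    Type (max u v w) :=
  (FreeLeavitt.ringCon K E).Quotient

namespace LeavittPathAlgebra

section Algebra

variable (K : Type w) [Field K] {V : Type u} {D : Type v} (E : DirGraph V D)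

noncomputable instance : NonUnitalRing (LeavittPathAlgebra K E) :=
  inferInstanceAs (NonUnitalRing (FreeLeavitt.ringCon K E).Quotient)

/-- The quotient map from the free algebra. -/
noncomputable def mk (x : FreeLeavitt K V D) : LeavittPathAlgebra K E :=
  (x : (FreeLeavitt.ringCon K E).Quotient)

variable {K E}

theorem mk_eq_mk {x y : FreeLeavitt K V D} :
    mk K E x = mk K E y ↔ FreeLeavitt.Rel K E x y :=
  (FreeLeavitt.ringCon K E).eq

theorem mk_surjective : Function.Surjective (mk K E) :=
  Quotient.mk''_surjective

theorem mk_zero : mk K E 0 = 0 := rfl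

theorem mk_add (x y : FreeLeavitt K V D) : mk K E (x + y) = mk K E x + mk K E y := rfl

theorem mk_mul (x y : FreeLeavitt K V D) : mk K E (x * y) = mk K E x * mk K E y := rfl

noncomputable instance : SMul K (LeavittPathAlgebra K E) where
  smul c := Quotient.map' (fun x => c • x) fun _ _ h => FreeLeavitt.Rel.smul c h

theorem mk_smul (c : K) (x : FreeLeavitt K V D) : mk K E (c • x) = c • mk K E x := rfl

noncomputable instance : Module K (LeavittPathAlgebra K E) :=
  Function.Surjective.module K (AddMonoidHom.mk' (mk K E) mk_add) mk_surjective mk_smul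

instance : IsScalarTower K (LeavittPathAlgebra K E) (LeavittPathAlgebra K E) where
  smul_assoc c x y := by
    obtain ⟨x, rfl⟩ := mk_surjective x
    obtain ⟨y, rfl⟩ := mk_surjective y
    simp only [smul_eq_mul, ← mk_smul, ← mk_mul, smul_mul_assoc]

instance : SMulCommClass K (LeavittPathAlgebra K E) (LeavittPathAlgebra K E) where
  smul_comm c x y := by
    obtain ⟨x, rfl⟩ := mk_surjective x
    obtain ⟨y, rfl⟩ := mk_surjective y
    simp only [smul_eq_mul, ← mk_smul, ← mk_mul, mul_smul_comm]

variable (K E)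

/-- A vertex, as an element of `L_K(E)`. -/
noncomputable def vertex (a : V) : LeavittPathAlgebra K E := mk K E (FreeLeavitt.gen K (.vertex a))

/-- An edge `e`, as an element of `L_K(E)`. -/
noncomputable def edge (e : D) : LeavittPathAlgebra K E := mk K E (FreeLeavitt.gen K (.edge e))

/-- The element `e*` of `L_K(E)`. -/
noncomputable def ghost (e : D) : LeavittPathAlgebra K E := mk K E (FreeLeavitt.gen K (.ghost e))

/-- The product `e₁ ⋯ eₙ a` in `L_K(E)`, where `a` is the final vertex. -/
noncomputable def listElem : V → List D → LeavittPathAlgebra K E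
  | a, [] => vertex K E a
  | _, e :: l => edge K E e * listElem (E.range e) l

/-- The element of `L_K(E)` given by a path `p = e₁ ⋯ eₙ`. (For `n > 0` it is written as
`e₁ ⋯ eₙ r(eₙ)`, which equals `e₁ ⋯ eₙ` by (E1).) -/
noncomputable def pathElem (p : E.Path) : LeavittPathAlgebra K E :=
  listElem K E p.source p.edges

end Algebra

section Involution

variable {K : Type w} [Field K] [StarRing K] {V : Type u} {D : Type v} {E : DirGraph V D}

/-- The involution of `L_K(E)`: conjugate-linear over the involution of `K`, anti-multiplicative,
fixing the vertices and exchanging `e` and `e*`. -/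
noncomputable instance : Star (LeavittPathAlgebra K E) where
  star := Quotient.map' (FreeLeavitt.freeStar K) fun _ _ h => FreeLeavitt.Rel.freeStar h

theorem star_mk (x : FreeLeavitt K V D) :
    star (mk K E x) = mk K E (FreeLeavitt.freeStar K x) := rfl

noncomputable instance : StarRing (LeavittPathAlgebra K E) where
  star_involutive x := by
    obtain ⟨x, rfl⟩ := mk_surjective x
    rw [star_mk, star_mk, FreeLeavitt.freeStar_freeStar]
  star_mul x y := by
    obtain ⟨x, rfl⟩ := mk_surjective x
    obtain ⟨y, rfl⟩ := mk_surjective y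
    rw [← mk_mul, star_mk, FreeLeavitt.freeStar_mul, mk_mul, star_mk, star_mk]
  star_add x y := by
    obtain ⟨x, rfl⟩ := mk_surjective x
    obtain ⟨y, rfl⟩ := mk_surjective y
    rw [← mk_add, star_mk, map_add, mk_add, star_mk, star_mk]

instance : StarModule K (LeavittPathAlgebra K E) where
  star_smul c x := by
    obtain ⟨x, rfl⟩ := mk_surjective x
    rw [← mk_smul, star_mk, FreeLeavitt.freeStar_smul, mk_smul, star_mk]

theorem star_vertex (a : V) : star (vertex K E a) = vertex K E a := by
  rw [vertex, star_mk, FreeLeavitt.freeStar_gen]; rfl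

theorem star_edge (e : D) : star (edge K E e) = ghost K E e := by
  rw [edge, star_mk, FreeLeavitt.freeStar_gen]; rfl

theorem star_ghost (e : D) : star (ghost K E e) = edge K E e := by
  rw [ghost, star_mk, FreeLeavitt.freeStar_gen]; rfl

open Classical in
/-- A map on `L_K(E)` is canonical if `t (p q*) = δ_{p,q} t (r(p))` for all paths `p` and `q`. -/
def IsCanonical {R : Type*} [Zero R] (t : LeavittPathAlgebra K E → R) : Prop :=
  ∀ p q : E.Path,
    t (pathElem K E p * star (pathElem K E q)) = if p = q then t (vertex K E p.range) else 0

/-- Condition (P): `t (a - ∑_{e ∈ I} r(e)) ≥ 0` for every vertex `a` and every finite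
`I ⊆ s⁻¹(a)`. -/
def ConditionP {R : Type*} [NonUnitalRing R] [StarRing R] (t : LeavittPathAlgebra K E → R) :
    Prop :=
  ∀ (a : V) (I : Finset D), (I : Set D) ⊆ E.emitted a →
    IsPos (t (vertex K E a - ∑ e ∈ I, vertex K E (E.range e)))

/-- Condition (F): `t a > 0` for every vertex `a`. -/
def ConditionF {R : Type*} [NonUnitalRing R] [StarRing R] (t : LeavittPathAlgebra K E → R) :
    Prop :=
  ∀ a : V, IsStrictlyPos (t (vertex K E a))

end Involution

end LeavittPathAlgebra

/-! # Faithfulness of canonical traces on Leavitt path algebras -/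

/-! ## Positive elements -/

section Positive

variable {A : Type*} [NonUnitalRing A] [StarRing A]

/-! For sufficiency it is enough to show, for every `x`, that `t (x x*)` is positive and vanishes
only if `x = 0`: a positive element is a sum of such squares, and positive terms of `R` cannot
cancel. Sorting the spanning elements `p q*` by the source of `q` gives `x = ∑ y_a` with `y_a = y_a
a`, so cross terms `y_a y_b*` vanish and a single `y = y a` remains.

Write `y = x₀ + ∑_{e ∈ I} z_e e*`, with `x₀` a combination of paths ending at `a`, and let `g = a -
∑_{e ∈ I} e e*` be the projection `gap`. Then `y y* = ∑_{e ∈ I} (y e)(y e)* + y g y*`. Each `y e`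
has shorter ghost paths, which permits induction. Since `e* g = 0` for `e ∈ I`, `y g = x₀ g`, and
canonicity diagonalises `t (x₀ g x₀*)` into `∑ c_p c_p* t(g)`, where `t(g)` is the element that (P)
declares positive. If this sum is zero, either every `c_p` is zero or `t(g) = 0`; in the latter case
(P) and (F) force `I` to be all of `s⁻¹(a)` and nonempty, so `g = 0` by (CK2). Either way `y g = 0`
(`IsCanonical.mul_gap_eq_zero`, `IsCanonical.isPos_map_mul_star_of_mem_depthLE`).

Conversely, vertices and gaps are projections, hence of the form `u u*`. Faithfulness gives (P) at
once, and (F) once vertices are known to be nonzero, which is seen in a concrete representation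
(`vertex_ne_zero`). -/

theorem IsPos.zero : IsPos (0 : A) := ⟨0, Fin.elim0, by simp⟩

theorem IsPos.mul_star (y : A) : IsPos (y * star y) := ⟨1, fun _ => y, by simp⟩

theorem IsPos.add {x y : A} (hx : IsPos x) (hy : IsPos y) : IsPos (x + y) := by
  obtain ⟨n, a, rfl⟩ := hx
  obtain ⟨m, b, rfl⟩ := hy
  exact ⟨n + m, Fin.append a b, by simp [Fin.sum_univ_add]⟩

theorem IsPos.sum {ι : Type*} (s : Finset ι) {f : ι → A} (h : ∀ i ∈ s, IsPos (f i)) :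
    IsPos (∑ i ∈ s, f i) :=
  Finset.sum_induction f IsPos (fun _ _ => IsPos.add) IsPos.zero h

/-- Concatenating the two families of squares gives one vanishing sum of squares, so positive
elements cannot cancel. -/
theorem IsPosDefStarRing.eq_zero_of_add_eq_zero (hA : IsPosDefStarRing A) {x y : A}
    (hx : IsPos x) (hy : IsPos y) (h : x + y = 0) : x = 0 := by
  obtain ⟨n, a, rfl⟩ := hx
  obtain ⟨m, b, rfl⟩ := hy
  have h0 := hA (n + m) (Fin.append a b) (by simpa [Fin.sum_univ_add] using h)
  refine Finset.sum_eq_zero fun i _ => ?_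
  have := h0 (Fin.castAdd m i)
  rw [Fin.append_left] at this
  rw [this, zero_mul]

theorem IsPosDefStarRing.eq_zero_of_sum_eq_zero (hA : IsPosDefStarRing A) {ι : Type*}
    (s : Finset ι) {f : ι → A} (hf : ∀ i ∈ s, IsPos (f i)) (h : ∑ i ∈ s, f i = 0) :
    ∀ i ∈ s, f i = 0 := by
  classical
  intro i hi
  rw [← Finset.add_sum_erase s f hi] at h
  exact hA.eq_zero_of_add_eq_zero (hf i hi)
    (IsPos.sum _ fun j hj => hf j (Finset.mem_of_mem_erase hj)) h

variable {K : Type*} [Field K] [StarRing K] [Module K A] [IsScalarTower K A A]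
  [SMulCommClass K A A] [StarModule K A]

theorem smul_mul_star_smul (c : K) (y : A) :
    (c • y) * star (c • y) = (c * star c) • (y * star y) := by
  rw [star_smul, smul_mul_assoc, mul_smul_comm, smul_smul]

theorem IsPos.smul_mul_star (c : K) {x : A} (hx : IsPos x) : IsPos ((c * star c) • x) := by
  obtain ⟨n, a, rfl⟩ := hx
  exact ⟨n, fun i => c • a i, by simp only [smul_mul_star_smul, Finset.smul_sum]⟩

/-- If `x = ∑ aᵢ aᵢ*`, then `(c c*) x = ∑ (c aᵢ)(c aᵢ)*`, so every `c aᵢ` vanishes. The positive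
definiteness used is that of `A`; none is assumed of `K`. -/
theorem IsPosDefStarRing.eq_zero_of_smul_eq_zero (hA : IsPosDefStarRing A) {c : K} {x : A}
    (hx : IsPos x) (hx0 : x ≠ 0) (h : (c * star c) • x = 0) : c = 0 := by
  obtain ⟨n, a, rfl⟩ := hx
  by_contra hc
  refine hx0 (Finset.sum_eq_zero fun i _ => ?_)
  have := hA n (fun i => c • a i) (by simpa only [smul_mul_star_smul, Finset.smul_sum] using h) i
  rw [(smul_eq_zero.mp this).resolve_left hc, zero_mul]

end Positive

/-! ## Vertices do not vanish -/

section Representation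

variable {V : Type u} {D : Type v}

/-- A set on which the edges act by injections such that, at every vertex that is not a sink, the
images of the edges that it emits form a partition. -/
theorem DirGraph.exists_branching_system (E : DirGraph V D) :
    ∃ (S : Type v) (_ : Nonempty S) (cons : D → S → S),
      (∀ e f s s', E.source e = E.source f → cons e s = cons f s' → e = f ∧ s = s') ∧
      ∀ e s, ∃ f s', E.source f = E.source e ∧ cons f s' = s := by
  classical
  -- The set `D ⊕ ℕ` is infinite and at least as large as each `s⁻¹(a)`, so it absorbs the factor
  -- `s⁻¹(a)`; infinite emitters need no separate treatment.
  have key : ∀ a : V, (E.emitted a).Nonempty →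
      Nonempty ((E.emitted a × (D ⊕ ULift.{v} ℕ)) ≃ (D ⊕ ULift.{v} ℕ)) := by
    intro a ha
    refine Cardinal.eq.mp ?_
    rw [Cardinal.mk_prod, Cardinal.lift_id, Cardinal.lift_id]
    have hne : Nonempty (E.emitted a) := ha.to_subtype
    refine Cardinal.mul_eq_right (Cardinal.aleph0_le_mk _) ?_ (Cardinal.mk_ne_zero _)
    exact Cardinal.mk_le_of_injective (f := fun x : E.emitted a => Sum.inl x.1)
      fun x y h => Subtype.ext (Sum.inl_injective h)
  choose g hg using fun a : V => show ∃ g : D → (D ⊕ ULift.{v} ℕ) → (D ⊕ ULift.{v} ℕ),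
      (∀ e f s s', E.source e = a → E.source f = a → g e s = g f s' → e = f ∧ s = s') ∧
      ((E.emitted a).Nonempty → ∀ s, ∃ f s', E.source f = a ∧ g f s' = s) by
    by_cases ha : (E.emitted a).Nonempty
    · obtain ⟨φ⟩ := key a ha
      refine ⟨fun e s => if he : E.source e = a then φ (⟨e, he⟩, s) else s, ?_, ?_⟩
      · intro e f s s' he hf h
        simp only [he, hf, dite_true] at h
        have := φ.injective h
        simpa [Subtype.ext_iff] using this
      · intro _ s
        refine ⟨(φ.symm s).1.1, (φ.symm s).2, (φ.symm s).1.2, ?_⟩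
        exact (dif_pos (show E.source (φ.symm s).1.1 = a from (φ.symm s).1.2)).trans
          (φ.apply_symm_apply s)
    · exact ⟨fun _ s => s, fun e _ _ _ he => absurd ⟨e, he⟩ ha, fun h => absurd h ha⟩
  refine ⟨D ⊕ ULift.{v} ℕ, ⟨Sum.inr ⟨0⟩⟩, fun e => g (E.source e) e, ?_, ?_⟩
  · intro e f s s' hef h
    refine (hg (E.source e)).1 e f s s' rfl hef.symm ?_
    dsimp only at h
    rw [h, hef]
  · intro e s
    obtain ⟨f, s', hf, h⟩ := (hg (E.source e)).2 ⟨e, rfl⟩ s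
    exact ⟨f, s', hf, by dsimp only; rw [hf, h]⟩

variable (K : Type w) [Field K]

open Classical in
/-- The action of the generators on functions, for a branching system. -/
noncomputable def DirGraph.genAction (E : DirGraph V D) {S : Type v} (cons : D → S → S) :
    LeavittGen V D → Module.End K (V → S → K)
  | .vertex a =>
    { toFun := fun f b s => if b = a then f b s else 0
      map_add' := fun f g => by ext b s; by_cases h : b = a <;> simp [h]
      map_smul' := fun c f => by ext b s; by_cases h : b = a <;> simp [h] }
  | .edge e =>
    { toFun := fun f b s => if h : b = E.source e ∧ ∃ s', cons e s' = s then
        f (E.range e) h.2.choose else 0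
      map_add' := fun f g => by
        ext b s; by_cases h : b = E.source e ∧ ∃ s', cons e s' = s <;> simp [h]
      map_smul' := fun c f => by
        ext b s; by_cases h : b = E.source e ∧ ∃ s', cons e s' = s <;> simp [h] }
  | .ghost e =>
    { toFun := fun f b s => if b = E.range e then f (E.source e) (cons e s) else 0
      map_add' := fun f g => by ext b s; by_cases h : b = E.range e <;> simp [h]
      map_smul' := fun c f => by ext b s; by_cases h : b = E.range e <;> simp [h] }

/-- The representation of the free algebra that extends `genAction`. -/
noncomputable def DirGraph.freeAction (E : DirGraph V D) {S : Type v} (cons : D → S → S) :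
    FreeLeavitt K V D →ₙₐ[K] Module.End K (V → S → K) :=
  MonoidAlgebra.liftMagma K (FreeSemigroup.lift (E.genAction K cons))

theorem DirGraph.freeAction_gen (E : DirGraph V D) {S : Type v} (cons : D → S → S)
    (g : LeavittGen V D) :
    E.freeAction K cons (FreeLeavitt.gen K g) = E.genAction K cons g := by
  simp [DirGraph.freeAction, FreeLeavitt.gen, MonoidAlgebra.liftMagma]

variable {K}

open Classical in
theorem DirGraph.genAction_vertex_apply (E : DirGraph V D) {S : Type v} (cons : D → S → S)
    (a : V) (f : V → S → K) (b : V) (s : S) :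
    E.genAction K cons (.vertex a) f b s = if b = a then f b s else 0 := rfl

open Classical in
theorem DirGraph.genAction_ghost_apply (E : DirGraph V D) {S : Type v} (cons : D → S → S)
    (e : D) (f : V → S → K) (b : V) (s : S) :
    E.genAction K cons (.ghost e) f b s =
      if b = E.range e then f (E.source e) (cons e s) else 0 := rfl

section

variable {E : DirGraph V D} {S : Type v} {cons : D → S → S}
  (hinj : ∀ e f s s', E.source e = E.source f → cons e s = cons f s' → e = f ∧ s = s')
include hinj

/-- Injectivity identifies the preimage picked by choice in `genAction` with the given `s`. -/
theorem DirGraph.genAction_edge_cons (e : D) (f : V → S → K) (s : S) :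
    E.genAction K cons (.edge e) f (E.source e) (cons e s) = f (E.range e) s := by
  have h : E.source e = E.source e ∧ ∃ s', cons e s' = cons e s := ⟨rfl, s, rfl⟩
  refine (dif_pos h).trans ?_
  rw [(hinj _ _ _ _ rfl h.2.choose_spec).2]

omit hinj in
theorem DirGraph.genAction_edge_of_not (e : D) (f : V → S → K) (b : V) (s : S)
    (h : ¬ (b = E.source e ∧ ∃ s', cons e s' = s)) :
    E.genAction K cons (.edge e) f b s = 0 :=
  dif_neg h

theorem DirGraph.genAction_edge_cons_of_ne {e f : D} (hef : e ≠ f) (x : V → S → K) (s : S) :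
    E.genAction K cons (.edge e) x (E.source f) (cons f s) = 0 := by
  refine genAction_edge_of_not e x _ _ ?_
  rintro ⟨h, s', hs'⟩
  exact hef (hinj _ _ _ _ h.symm hs').1

/-- Injectivity and disjointness of the images yield (CK1); that these images cover `S` yields
(CK2). -/
theorem DirGraph.freeAction_eq_of_rel
    (hsurj : ∀ e s, ∃ f s', E.source f = E.source e ∧ cons f s' = s)
    {x y : FreeLeavitt K V D} (h : FreeLeavitt.Rel K E x y) :
    E.freeAction K cons x = E.freeAction K cons y := by
  induction h with
  | vertex_mul_self a =>
    rw [map_mul, freeAction_gen]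
    ext f b s
    simp only [Module.End.mul_apply, genAction_vertex_apply]
    split_ifs <;> rfl
  | vertex_mul_of_ne a b hab =>
    rw [map_mul, freeAction_gen, freeAction_gen, map_zero]
    ext f c s
    simp only [Module.End.mul_apply, genAction_vertex_apply]
    split_ifs with h1 h2
    · exact absurd (h1.symm.trans h2) hab
    · rfl
    · rfl
  | source_mul_edge e =>
    rw [map_mul, freeAction_gen, freeAction_gen]
    ext f b s
    simp only [Module.End.mul_apply, genAction_vertex_apply]
    split_ifs with h1
    · rfl
    · exact (genAction_edge_of_not e f b s fun h => h1 h.1).symm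
  | edge_mul_range e =>
    rw [map_mul, freeAction_gen, freeAction_gen]
    ext f b s
    rw [Module.End.mul_apply]
    by_cases h : b = E.source e ∧ ∃ s', cons e s' = s
    · obtain ⟨rfl, s', rfl⟩ := h
      rw [genAction_edge_cons hinj, genAction_edge_cons hinj, genAction_vertex_apply, if_pos rfl]
    · rw [genAction_edge_of_not _ _ _ _ h, genAction_edge_of_not _ _ _ _ h]
  | range_mul_ghost e =>
    rw [map_mul, freeAction_gen, freeAction_gen]
    ext f b s
    simp only [Module.End.mul_apply, genAction_vertex_apply, genAction_ghost_apply]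
    split_ifs <;> rfl
  | ghost_mul_source e =>
    rw [map_mul, freeAction_gen, freeAction_gen]
    ext f b s
    simp only [Module.End.mul_apply, genAction_vertex_apply, genAction_ghost_apply, if_true]
  | ghost_mul_edge_self e =>
    rw [map_mul, freeAction_gen, freeAction_gen, freeAction_gen]
    ext f b s
    rw [Module.End.mul_apply, genAction_ghost_apply, genAction_vertex_apply,
      genAction_edge_cons hinj]
    split_ifs with h
    · rw [h]
    · rfl
  | ghost_mul_edge_of_ne e f hef =>
    rw [map_mul, freeAction_gen, freeAction_gen, map_zero]
    ext x b s
    rw [Module.End.mul_apply, genAction_ghost_apply, genAction_edge_cons_of_ne hinj hef.symm,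
      ite_self]
    rfl
  | regular a hfin hne =>
    simp only [map_sum, map_mul, freeAction_gen]
    ext x b s
    simp only [LinearMap.sum_apply, Finset.sum_apply, Module.End.mul_apply]
    obtain ⟨e₀, rfl⟩ : ∃ e, E.source e = a := hne
    rw [genAction_vertex_apply]
    split_ifs with hb
    · subst hb
      -- The point lies in the image of exactly one edge `f` emitted by this vertex, so only the
      -- summand of `f` survives.
      obtain ⟨f, s', hf, rfl⟩ := hsurj e₀ s
      rw [Finset.sum_eq_single f]
      · rw [← hf, genAction_edge_cons hinj, genAction_ghost_apply, if_pos rfl]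
      · intro e _ hef
        rw [← hf]
        exact genAction_edge_cons_of_ne hinj hef _ _
      · intro h
        exact absurd (hfin.mem_toFinset.mpr hf) h
    · refine (Finset.sum_eq_zero fun e he => genAction_edge_of_not _ _ _ _ fun h => hb ?_).symm
      exact h.1.trans (hfin.mem_toFinset.mp he)
  | refl x => rfl
  | symm _ ih => exact ih.symm
  | trans _ _ ih₁ ih₂ => exact ih₁.trans ih₂
  | add _ _ ih₁ ih₂ => rw [map_add, map_add, ih₁, ih₂]
  | mul _ _ ih₁ ih₂ => rw [map_mul, map_mul, ih₁, ih₂]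
  | smul c _ ih => rw [map_smul, map_smul, ih]

end

/-- In the representation on functions on `V × S`, the vertex `a` sends the constant function `1` to
the indicator function of `{a} × S`. -/
theorem LeavittPathAlgebra.vertex_ne_zero (E : DirGraph V D) (a : V) : vertex K E a ≠ 0 := by
  intro h
  obtain ⟨S, ⟨s⟩, cons, hinj, hsurj⟩ := E.exists_branching_system
  have h1 := DirGraph.freeAction_eq_of_rel hinj hsurj (mk_eq_mk.mp (h.trans mk_zero.symm))
  rw [DirGraph.freeAction_gen, map_zero] at h1
  have h2 := congr_fun (congr_fun (LinearMap.congr_fun h1 (fun _ _ => (1 : K))) a) s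
  rw [DirGraph.genAction_vertex_apply, if_pos rfl] at h2
  exact one_ne_zero h2

end Representation

/-! ## Paths -/

namespace DirGraph

variable {V : Type u} {D : Type v} {E : DirGraph V D}

theorem isPathFrom_concat {a : V} {l : List D} {e : D} (h : E.IsPathFrom a l)
    (he : E.source e = E.endpoint a l) : E.IsPathFrom a (l ++ [e]) := by
  induction l generalizing a with
  | nil => exact ⟨he, trivial⟩
  | cons f l ih => exact ⟨h.1, ih h.2 he⟩

theorem endpoint_concat (a : V) (l : List D) (e : D) : E.endpoint a (l ++ [e]) = E.range e := by
  induction l generalizing a with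
  | nil => rfl
  | cons f l ih => exact ih _

/-- The path of length zero at a vertex. -/
def Path.ofVertex (E : DirGraph V D) (a : V) : E.Path := ⟨a, [], trivial⟩

/-- A path with an edge put in front of it. -/
def Path.cons (e : D) (p : E.Path) (h : p.source = E.range e) : E.Path :=
  ⟨E.source e, e :: p.edges, rfl, h ▸ p.isPath⟩

theorem Path.range_cons (e : D) (p : E.Path) (h : p.source = E.range e) :
    (p.cons e h).range = p.range := by
  change E.endpoint (E.range e) p.edges = E.endpoint p.source p.edges
  rw [h]

/-- A path followed by an edge. -/
def Path.concat (p : E.Path) (e : D) (h : E.source e = p.range) : E.Path :=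
  ⟨p.source, p.edges ++ [e], isPathFrom_concat p.isPath h⟩

theorem Path.range_concat (p : E.Path) (e : D) (h : E.source e = p.range) :
    (p.concat e h).range = E.range e :=
  endpoint_concat _ _ _

theorem Path.concat_inj {p q : E.Path} {e : D} {hp : E.source e = p.range}
    {hq : E.source e = q.range} : p.concat e hp = q.concat e hq ↔ p = q := by
  refine ⟨fun h => ?_, fun h => by subst h; rfl⟩
  have h1 := congrArg Path.source h
  have h2 := congrArg Path.edges h
  exact Path.ext h1 (List.append_cancel_right h2)

end DirGraph

/-! ## Calculus in the Leavitt path algebra -/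

namespace LeavittPathAlgebra

variable {K : Type w} [Field K] {V : Type u} {D : Type v} {E : DirGraph V D}

theorem vertex_mul_self (a : V) : vertex K E a * vertex K E a = vertex K E a :=
  mk_eq_mk.mpr (.vertex_mul_self a)

theorem vertex_mul_of_ne {a b : V} (h : a ≠ b) : vertex K E a * vertex K E b = 0 :=
  mk_eq_mk.mpr (.vertex_mul_of_ne a b h)

theorem source_mul_edge (e : D) : vertex K E (E.source e) * edge K E e = edge K E e :=
  mk_eq_mk.mpr (.source_mul_edge e)

theorem edge_mul_range (e : D) : edge K E e * vertex K E (E.range e) = edge K E e :=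
  mk_eq_mk.mpr (.edge_mul_range e)

theorem range_mul_ghost (e : D) : vertex K E (E.range e) * ghost K E e = ghost K E e :=
  mk_eq_mk.mpr (.range_mul_ghost e)

theorem ghost_mul_source (e : D) : ghost K E e * vertex K E (E.source e) = ghost K E e :=
  mk_eq_mk.mpr (.ghost_mul_source e)

theorem ghost_mul_edge_self (e : D) : ghost K E e * edge K E e = vertex K E (E.range e) :=
  mk_eq_mk.mpr (.ghost_mul_edge_self e)

theorem ghost_mul_edge_of_ne {e f : D} (h : e ≠ f) : ghost K E e * edge K E f = 0 :=
  mk_eq_mk.mpr (.ghost_mul_edge_of_ne e f h)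

/-- The quotient map as an additive map. -/
noncomputable def mkAddHom (K : Type w) [Field K] (E : DirGraph V D) :
    FreeLeavitt K V D →+ LeavittPathAlgebra K E :=
  AddMonoidHom.mk' (mk K E) mk_add

theorem vertex_eq_sum (a : V) (hfin : (E.emitted a).Finite) (hne : (E.emitted a).Nonempty) :
    vertex K E a = ∑ e ∈ hfin.toFinset, edge K E e * ghost K E e :=
  (mk_eq_mk.mpr (.regular a hfin hne)).trans (map_sum (mkAddHom K E) _ _)

theorem edge_mul_vertex_of_ne {a : V} {e : D} (h : E.range e ≠ a) :
    edge K E e * vertex K E a = 0 := by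
  rw [← edge_mul_range, mul_assoc, vertex_mul_of_ne h, mul_zero]

theorem ghost_mul_vertex_of_ne {a : V} {e : D} (h : E.source e ≠ a) :
    ghost K E e * vertex K E a = 0 := by
  rw [← ghost_mul_source, mul_assoc, vertex_mul_of_ne h, mul_zero]

theorem vertex_mul_listElem {a : V} {l : List D} (h : E.IsPathFrom a l) :
    vertex K E a * listElem K E a l = listElem K E a l := by
  cases l with
  | nil => exact vertex_mul_self a
  | cons e l =>
    obtain ⟨rfl, -⟩ := h
    rw [listElem, ← mul_assoc, source_mul_edge]

theorem listElem_mul_endpoint (a : V) (l : List D) :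
    listElem K E a l * vertex K E (E.endpoint a l) = listElem K E a l := by
  induction l generalizing a with
  | nil => exact vertex_mul_self a
  | cons e l ih => rw [listElem, mul_assoc, DirGraph.endpoint, ih]

theorem listElem_concat (a : V) (l : List D) (e : D) (he : E.source e = E.endpoint a l) :
    listElem K E a (l ++ [e]) = listElem K E a l * edge K E e := by
  induction l generalizing a with
  | nil =>
    change E.source e = a at he
    subst he
    change edge K E e * vertex K E (E.range e) = vertex K E (E.source e) * edge K E e
    rw [edge_mul_range, source_mul_edge]
  | cons f l ih => rw [List.cons_append, listElem, listElem, ih _ he, mul_assoc]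

theorem vertex_mul_pathElem (p : E.Path) : vertex K E p.source * pathElem K E p = pathElem K E p :=
  vertex_mul_listElem p.isPath

theorem pathElem_mul_vertex (p : E.Path) : pathElem K E p * vertex K E p.range = pathElem K E p :=
  listElem_mul_endpoint _ _

theorem pathElem_ofVertex (a : V) : pathElem K E (.ofVertex E a) = vertex K E a := rfl

theorem pathElem_concat (p : E.Path) (e : D) (h : E.source e = p.range) :
    pathElem K E (p.concat e h) = pathElem K E p * edge K E e :=
  listElem_concat _ _ _ h

theorem pathElem_cons (e : D) (p : E.Path) (h : p.source = E.range e) :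
    pathElem K E (p.cons e h) = edge K E e * pathElem K E p := by
  change edge K E e * listElem K E (E.range e) p.edges = _
  rw [← h]
  rfl

/-! ### The span of the `p q*` with `q` of bounded length -/

variable (K E) in
/-- The span of the paths that end at the vertex. -/
noncomputable def pathsTo (a : V) : Submodule K (LeavittPathAlgebra K E) :=
  Submodule.span K (Set.range fun p : {p : E.Path // p.range = a} => pathElem K E p.1)

variable (K E) in
/-- The span of the `p q*`, with `q` a path of length at most `n` that starts at the vertex. -/
noncomputable def depthLE : ℕ → V → Submodule K (LeavittPathAlgebra K E)
  | 0, a => pathsTo K E a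
  | n + 1, a => pathsTo K E a ⊔
      ⨆ e : E.emitted a, (depthLE n (E.range e)).map (LinearMap.mulRight K (ghost K E e.1))

theorem pathElem_mem_pathsTo {a : V} (p : E.Path) (h : p.range = a) :
    pathElem K E p ∈ pathsTo K E a :=
  Submodule.subset_span ⟨⟨p, h⟩, rfl⟩

theorem pathsTo_le_depthLE (n : ℕ) (a : V) : pathsTo K E a ≤ depthLE K E n a := by
  cases n with
  | zero => exact le_rfl
  | succ n => exact le_sup_left

theorem mul_ghost_mem_depthLE {n : ℕ} {e : D} {x : LeavittPathAlgebra K E}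
    (h : x ∈ depthLE K E n (E.range e)) :
    x * ghost K E e ∈ depthLE K E (n + 1) (E.source e) :=
  (le_sup_right : _ ≤ depthLE K E (n + 1) (E.source e)) <|
    Submodule.mem_iSup_of_mem (⟨e, rfl⟩ : E.emitted (E.source e)) ⟨x, h, rfl⟩

theorem depthLE_le_succ (n : ℕ) (a : V) : depthLE K E n a ≤ depthLE K E (n + 1) a := by
  induction n generalizing a with
  | zero => exact le_sup_left
  | succ n ih =>
    refine sup_le le_sup_left (le_sup_of_le_right (iSup_mono fun e => ?_))
    exact Submodule.map_mono (ih _)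

theorem depthLE_mono (a : V) : Monotone fun n => depthLE K E n a :=
  monotone_nat_of_le_succ fun n => depthLE_le_succ n a

theorem mul_vertex_of_mem_pathsTo {a : V} {x : LeavittPathAlgebra K E}
    (h : x ∈ pathsTo K E a) : x * vertex K E a = x := by
  have : pathsTo K E a ≤
      LinearMap.ker (LinearMap.mulRight K (vertex K E a) - LinearMap.id) := by
    refine Submodule.span_le.mpr ?_
    rintro _ ⟨⟨p, rfl⟩, rfl⟩
    exact sub_eq_zero.mpr (pathElem_mul_vertex p)
  exact sub_eq_zero.mp (this h)

theorem mul_vertex_of_mem_depthLE {n : ℕ} {a : V} {x : LeavittPathAlgebra K E}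
    (h : x ∈ depthLE K E n a) : x * vertex K E a = x := by
  cases n with
  | zero => exact mul_vertex_of_mem_pathsTo h
  | succ n =>
    have : depthLE K E (n + 1) a ≤
        LinearMap.ker (LinearMap.mulRight K (vertex K E a) - LinearMap.id) := by
      refine sup_le (fun x hx => sub_eq_zero.mpr (mul_vertex_of_mem_pathsTo hx)) (iSup_le ?_)
      rintro ⟨e, rfl⟩ _ ⟨x, -, rfl⟩
      refine sub_eq_zero.mpr ?_
      change x * ghost K E e * vertex K E (E.source e) = x * ghost K E e
      rw [mul_assoc, ghost_mul_source]
    exact sub_eq_zero.mp (this h)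

theorem mul_edge_mem_pathsTo {e : D} {x : LeavittPathAlgebra K E}
    (h : x ∈ pathsTo K E (E.source e)) : x * edge K E e ∈ pathsTo K E (E.range e) := by
  have : pathsTo K E (E.source e) ≤
      (pathsTo K E (E.range e)).comap (LinearMap.mulRight K (edge K E e)) := by
    refine Submodule.span_le.mpr ?_
    rintro _ ⟨⟨p, hp⟩, rfl⟩
    change pathElem K E p * edge K E e ∈ pathsTo K E (E.range e)
    rw [← pathElem_concat p e hp.symm]
    exact pathElem_mem_pathsTo _ (p.range_concat e _)
  exact this h

/-- Depth is gained only when a ghost edge meets a path of length zero; on a longer path it cancels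
the first edge or gives zero. -/
theorem gen_mul_mem_depthLE_one (g : LeavittGen V D) (a : V) :
    pathsTo K E a ≤ (depthLE K E 1 a).comap
      (LinearMap.mulLeft K (mk K E (FreeLeavitt.gen K g))) := by
  refine Submodule.span_le.mpr ?_
  rintro _ ⟨⟨p, rfl⟩, rfl⟩
  change mk K E (FreeLeavitt.gen K g) * pathElem K E p ∈ depthLE K E 1 p.range
  cases g with
  | vertex b =>
    change vertex K E b * pathElem K E p ∈ depthLE K E 1 p.range
    by_cases hb : b = p.source
    · rw [hb, vertex_mul_pathElem]
      exact pathsTo_le_depthLE _ _ (pathElem_mem_pathsTo p rfl)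
    · rw [← vertex_mul_pathElem, ← mul_assoc, vertex_mul_of_ne hb, zero_mul]
      exact zero_mem _
  | edge e =>
    change edge K E e * pathElem K E p ∈ depthLE K E 1 p.range
    by_cases he : p.source = E.range e
    · rw [← pathElem_cons e p he]
      exact pathsTo_le_depthLE _ _ (pathElem_mem_pathsTo _ (p.range_cons e he))
    · rw [← vertex_mul_pathElem, ← mul_assoc, edge_mul_vertex_of_ne (Ne.symm he), zero_mul]
      exact zero_mem _
  | ghost e =>
    change ghost K E e * pathElem K E p ∈ depthLE K E 1 p.range
    obtain ⟨b, l, hl⟩ := p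
    cases l with
    | nil =>
      change ghost K E e * vertex K E b ∈ depthLE K E 1 b
      by_cases he : E.source e = b
      · subst he
        rw [ghost_mul_source, ← range_mul_ghost]
        exact mul_ghost_mem_depthLE (n := 0) (pathElem_mem_pathsTo (.ofVertex E _) rfl)
      · rw [ghost_mul_vertex_of_ne he]
        exact zero_mem _
    | cons f l =>
      change ghost K E e * (edge K E f * listElem K E (E.range f) l) ∈
        depthLE K E 1 (E.endpoint (E.range f) l)
      rw [← mul_assoc]
      by_cases hef : e = f
      · subst hef
        rw [ghost_mul_edge_self, vertex_mul_listElem hl.2]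
        exact pathsTo_le_depthLE _ _ (pathElem_mem_pathsTo ⟨E.range e, l, hl.2⟩ rfl)
      · rw [ghost_mul_edge_of_ne hef, zero_mul]
        exact zero_mem _

/-- Left multiplication by a generator raises the depth by at most one. -/
theorem gen_mul_mem_depthLE (g : LeavittGen V D) (n : ℕ) (a : V) :
    depthLE K E n a ≤ (depthLE K E (n + 1) a).comap
      (LinearMap.mulLeft K (mk K E (FreeLeavitt.gen K g))) := by
  induction n generalizing a with
  | zero => exact gen_mul_mem_depthLE_one g a
  | succ n ih =>
    refine sup_le (fun x hx => depthLE_mono a (show 1 ≤ n + 1 + 1 by omega) (gen_mul_mem_depthLE_one g a hx))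
      (iSup_le ?_)
    rintro ⟨e, rfl⟩ _ ⟨x, hx, rfl⟩
    change mk K E (FreeLeavitt.gen K g) * (x * ghost K E e) ∈ depthLE K E (n + 1 + 1) (E.source e)
    rw [← mul_assoc]
    exact mul_ghost_mem_depthLE (ih _ hx)

theorem gen_mem_iSup_depthLE (g : LeavittGen V D) :
    mk K E (FreeLeavitt.gen K g) ∈ ⨆ a, ⨆ n, depthLE K E n a := by
  cases g with
  | vertex a =>
    exact Submodule.mem_iSup_of_mem a (Submodule.mem_iSup_of_mem 0
      (pathElem_mem_pathsTo (.ofVertex E a) rfl))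
  | edge e =>
    refine Submodule.mem_iSup_of_mem (E.range e) (Submodule.mem_iSup_of_mem 0 ?_)
    change edge K E e ∈ depthLE K E 0 (E.range e)
    rw [← source_mul_edge]
    exact mul_edge_mem_pathsTo (pathElem_mem_pathsTo (.ofVertex E _) rfl)
  | ghost e =>
    refine Submodule.mem_iSup_of_mem (E.source e) (Submodule.mem_iSup_of_mem 1 ?_)
    change ghost K E e ∈ depthLE K E 1 (E.source e)
    rw [← range_mul_ghost]
    exact mul_ghost_mem_depthLE (n := 0) (pathElem_mem_pathsTo (.ofVertex E _) rfl)

/-- The sum of these subspaces contains the generators and is stable under left multiplication by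
them, so it contains every word. -/
theorem iSup_depthLE : ⨆ a, ⨆ n, depthLE K E n a = ⊤ := by
  have hgen (g : LeavittGen V D) : (⨆ a, ⨆ n, depthLE K E n a) ≤
      (⨆ a, ⨆ n, depthLE K E n a).comap
        (LinearMap.mulLeft K (mk K E (FreeLeavitt.gen K g))) := by
    refine iSup_le fun a => iSup_le fun n x hx => ?_
    exact Submodule.mem_iSup_of_mem a (Submodule.mem_iSup_of_mem (n + 1)
      (gen_mul_mem_depthLE g n a hx))
  have hword (m : FreeSemigroup (LeavittGen V D)) :
      mk K E (MonoidAlgebra.single m 1) ∈ ⨆ a, ⨆ n, depthLE K E n a := by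
    induction m using FreeSemigroup.recOnMul with
    | ih1 g => exact gen_mem_iSup_depthLE g
    | ih2 g y _ hy =>
      have : mk K E (MonoidAlgebra.single (FreeSemigroup.of g * y) 1) =
          mk K E (FreeLeavitt.gen K g) * mk K E (MonoidAlgebra.single y 1) := by
        rw [← mk_mul, FreeLeavitt.gen, MonoidAlgebra.single_mul_single, one_mul]
      rw [this]
      exact hgen g hy
  refine eq_top_iff.mpr fun x _ => ?_
  obtain ⟨x, rfl⟩ := mk_surjective x
  induction x using MonoidAlgebra.induction_linear with
  | zero => exact zero_mem _
  | add f g hf hg => exact add_mem (hf trivial) (hg trivial)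
  | single m r =>
    rw [← mul_one r, ← smul_eq_mul, ← MonoidAlgebra.smul_single, mk_smul]
    exact Submodule.smul_mem _ _ (hword m)

/-- Every element is a finite sum of elements of bounded depth at distinct vertices. -/
theorem exists_sum_depthLE (x : LeavittPathAlgebra K E) :
    ∃ (s : Finset V) (y : V → LeavittPathAlgebra K E),
      (∀ a, ∃ n, y a ∈ depthLE K E n a) ∧ x = ∑ a ∈ s, y a := by
  have hx : x ∈ ⨆ a, ⨆ n, depthLE K E n a := iSup_depthLE (K := K) (E := E) ▸ Submodule.mem_top
  obtain ⟨f, hf, rfl⟩ := (Submodule.mem_iSup_iff_exists_finsupp _ _).mp hx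
  exact ⟨f.support, f,
    -- The depths at a fixed vertex form a chain, so a member of their supremum lies in one of them.
    fun a => (Submodule.mem_iSup_of_directed _ (depthLE_mono a).directed_le).mp (hf a), rfl⟩

theorem exists_of_mem_depthLE_succ {n : ℕ} {a : V} {x : LeavittPathAlgebra K E}
    (h : x ∈ depthLE K E (n + 1) a) :
    ∃ y ∈ pathsTo K E a, ∃ (I : Finset D) (z : D → LeavittPathAlgebra K E),
      (I : Set D) ⊆ E.emitted a ∧ (∀ e ∈ I, z e ∈ depthLE K E n (E.range e)) ∧
      x = y + ∑ e ∈ I, z e * ghost K E e := by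
  classical
  obtain ⟨y, hy, w, hw, rfl⟩ := Submodule.mem_sup.mp h
  refine ⟨y, hy, ?_⟩
  obtain ⟨f, hf, rfl⟩ := (Submodule.mem_iSup_iff_exists_finsupp _ _).mp hw
  choose z hz hz' using hf
  -- Coefficients are known only for edges emitted by `a`; extension by zero indexes them by all
  -- edges.
  obtain ⟨w, hw⟩ : ∃ w : D → LeavittPathAlgebra K E, ∀ e : E.emitted a, w e = z e :=
    ⟨Function.extend Subtype.val z 0, Subtype.val_injective.extend_apply _ _⟩
  refine ⟨f.support.map (Function.Embedding.subtype _), w, ?_, ?_, ?_⟩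
  · intro e he
    obtain ⟨e', -, rfl⟩ := Finset.mem_map.mp (Finset.mem_coe.mp he)
    exact e'.2
  · intro e he
    obtain ⟨e', -, rfl⟩ := Finset.mem_map.mp he
    exact (hw e').symm ▸ hz e'
  · rw [Finset.sum_map, Finsupp.sum]
    congr 1
    refine Finset.sum_congr rfl fun e _ => ?_
    rw [← hz' e, ← hw e]
    rfl

end LeavittPathAlgebra

/-! ## Faithful canonical traces -/

namespace LeavittPathAlgebra

variable {K : Type w} [Field K] {V : Type u} {D : Type v} {E : DirGraph V D}

/-! ### The projections `a - ∑_{e ∈ I} e e*` -/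

variable (K E) in
/-- The idempotent `a - ∑_{e ∈ I} e e*`. -/
noncomputable def gap (a : V) (I : Finset D) : LeavittPathAlgebra K E :=
  vertex K E a - ∑ e ∈ I, edge K E e * ghost K E e

theorem ghost_mul_gap {a : V} {I : Finset D} (hI : (I : Set D) ⊆ E.emitted a) {e : D}
    (he : e ∈ I) : ghost K E e * gap K E a I = 0 := by
  obtain rfl : E.source e = a := hI he
  rw [gap, mul_sub, ghost_mul_source, Finset.mul_sum, Finset.sum_eq_single_of_mem e he,
    ← mul_assoc, ghost_mul_edge_self, range_mul_ghost, sub_self]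
  intro f _ hf
  rw [← mul_assoc, ghost_mul_edge_of_ne hf.symm, zero_mul]

theorem vertex_mul_gap {a : V} {I : Finset D} (hI : (I : Set D) ⊆ E.emitted a) :
    vertex K E a * gap K E a I = gap K E a I := by
  rw [gap, mul_sub, vertex_mul_self, Finset.mul_sum]
  congr 1
  refine Finset.sum_congr rfl fun e he => ?_
  obtain rfl : E.source e = a := hI he
  rw [← mul_assoc, source_mul_edge]

theorem gap_mul_self {a : V} {I : Finset D} (hI : (I : Set D) ⊆ E.emitted a) :
    gap K E a I * gap K E a I = gap K E a I := by
  nth_rw 1 [gap]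
  rw [sub_mul, vertex_mul_gap hI, Finset.sum_mul, Finset.sum_eq_zero, sub_zero]
  intro e he
  rw [mul_assoc, ghost_mul_gap hI he, mul_zero]

/-- This is (CK2). Nonemptiness matters: at a sink the gap is the vertex itself. -/
theorem gap_eq_zero {a : V} {I : Finset D} (hI : (I : Set D) = E.emitted a) (hne : I.Nonempty) :
    gap K E a I = 0 := by
  have hfin : (E.emitted a).Finite := hI ▸ I.finite_toSet
  have : hfin.toFinset = I := by
    ext e
    rw [Set.Finite.mem_toFinset, ← hI, Finset.mem_coe]
  rw [gap, vertex_eq_sum a hfin (hI ▸ hne), this, sub_self]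

variable [StarRing K]

theorem star_gap (a : V) (I : Finset D) : star (gap K E a I) = gap K E a I := by
  simp only [gap, star_sub, star_sum, star_mul, star_vertex, star_edge, star_ghost]

/-- The decomposition of `y y*` along `a = ∑_{e ∈ I} e e* + (a - ∑_{e ∈ I} e e*)`. -/
theorem mul_star_eq_sum_add {a : V} (I : Finset D) {y : LeavittPathAlgebra K E}
    (hy : y * vertex K E a = y) :
    y * star y = ∑ e ∈ I, (y * edge K E e) * star (y * edge K E e) +
      y * gap K E a I * star y := by
  have h : y * (gap K E a I + ∑ e ∈ I, edge K E e * ghost K E e) = y := by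
    rw [gap, sub_add_cancel, hy]
  nth_rw 1 [← h]
  rw [mul_add, add_mul, add_comm, Finset.mul_sum, Finset.sum_mul]
  simp only [star_mul, star_edge, mul_assoc]

theorem mul_star_of_mem_depthLE_of_ne {n m : ℕ} {a b : V} (hab : a ≠ b)
    {x y : LeavittPathAlgebra K E} (hx : x ∈ depthLE K E n a) (hy : y ∈ depthLE K E m b) :
    x * star y = 0 := by
  rw [← mul_vertex_of_mem_depthLE hx, ← mul_vertex_of_mem_depthLE hy, star_mul, star_vertex,
    mul_assoc, ← mul_assoc (vertex K E a), vertex_mul_of_ne hab, zero_mul, mul_zero]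

/-! ### Values of a canonical trace on gaps -/

variable {R : Type z} [NonUnitalRing R] [Module K R]
  {t : LeavittPathAlgebra K E →ₗ[K] R}

theorem IsCanonical.map_edge_mul_ghost (hcan : IsCanonical t) (e : D) :
    t (edge K E e * ghost K E e) = t (vertex K E (E.range e)) := by
  have he : E.source e = (DirGraph.Path.ofVertex E (E.source e)).range := rfl
  have h := hcan ((DirGraph.Path.ofVertex E (E.source e)).concat e he)
    ((DirGraph.Path.ofVertex E (E.source e)).concat e he)
  rwa [if_pos rfl, DirGraph.Path.range_concat, pathElem_concat, pathElem_ofVertex,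
    source_mul_edge, star_edge] at h

theorem IsCanonical.map_gap (hcan : IsCanonical t) (a : V) (I : Finset D) :
    t (gap K E a I) = t (vertex K E a - ∑ e ∈ I, vertex K E (E.range e)) := by
  simp only [gap, map_sub, map_sum, hcan.map_edge_mul_ghost]

open Classical in
-- The product expands as `p q* - ∑ (p e)(q e)*`, and `p e = q e` exactly when `p = q`, so
-- canonicity applies to each term with the same Kronecker delta.
theorem IsCanonical.map_path_mul_gap_mul_star (hcan : IsCanonical t) {a : V} {I : Finset D}
    (hI : (I : Set D) ⊆ E.emitted a) {p q : E.Path} (hp : p.range = a) (hq : q.range = a) :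
    t (pathElem K E p * gap K E a I * star (pathElem K E q)) =
      if p = q then t (gap K E a I) else 0 := by
  subst hp
  have h1 : pathElem K E p * gap K E p.range I * star (pathElem K E q) =
      pathElem K E p * star (pathElem K E q) -
        ∑ e ∈ I, (pathElem K E p * edge K E e) * star (pathElem K E q * edge K E e) := by
    simp only [gap, mul_sub, sub_mul, pathElem_mul_vertex, Finset.mul_sum, Finset.sum_mul,
      star_mul, star_edge, mul_assoc]
  have h2 : ∀ e ∈ I,
      t ((pathElem K E p * edge K E e) * star (pathElem K E q * edge K E e)) =
        if p = q then t (vertex K E (E.range e)) else 0 := by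
    intro e he
    have hep : E.source e = p.range := hI he
    have heq : E.source e = q.range := hep.trans hq.symm
    rw [← pathElem_concat p e hep, ← pathElem_concat q e heq, hcan,
      DirGraph.Path.range_concat]
    simp only [DirGraph.Path.concat_inj]
  rw [h1, map_sub, map_sum, hcan, Finset.sum_congr rfl h2, hcan.map_gap]
  split_ifs
  · rw [map_sub, map_sum]
  · simp

/-- The off-diagonal terms of the double sum have trace zero. The same coefficients must serve both
equations, so that vanishing of the `c p` gives `y = 0`. -/
theorem IsCanonical.exists_map_mul_gap_mul_star (hcan : IsCanonical t) {a : V} {I : Finset D}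
    (hI : (I : Set D) ⊆ E.emitted a) {y : LeavittPathAlgebra K E} (hy : y ∈ pathsTo K E a) :
    ∃ (s : Finset {p : E.Path // p.range = a}) (c : {p : E.Path // p.range = a} → K),
      y = ∑ p ∈ s, c p • pathElem K E p.1 ∧
      t (y * gap K E a I * star y) = ∑ p ∈ s, (c p * star (c p)) • t (gap K E a I) := by
  classical
  obtain ⟨c, rfl⟩ := Finsupp.mem_span_range_iff_exists_finsupp.mp hy
  refine ⟨c.support, c, rfl, ?_⟩
  simp only [Finsupp.sum, star_sum, Finset.sum_mul, Finset.mul_sum, star_smul, smul_mul_assoc,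
    mul_smul_comm, map_sum, map_smul]
  refine Finset.sum_congr rfl fun q hq => ?_
  rw [Finset.sum_eq_single_of_mem q hq, hcan.map_path_mul_gap_mul_star hI q.2 q.2, if_pos rfl,
    smul_smul, mul_comm]
  intro p _ hpq
  rw [hcan.map_path_mul_gap_mul_star hI p.2 q.2, if_neg fun h => hpq (Subtype.ext h), smul_zero]

/-! ### From (P) and (F) to faithfulness -/

variable [StarRing R]

/-- The trace of `a - ∑_{e ∈ I} e e*` vanishes only if this element does. -/
theorem IsCanonical.gap_eq_zero_of_map_eq_zero (hR : IsPosDefStarRing R) (hcan : IsCanonical t)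
    (hP : ConditionP t) (hF : ConditionF t) {a : V} {I : Finset D}
    (hI : (I : Set D) ⊆ E.emitted a) (h : t (gap K E a I) = 0) : gap K E a I = 0 := by
  classical
  rcases I.eq_empty_or_nonempty with rfl | hne
  -- For empty `I` the gap is `a` itself, whose trace is nonzero by (F).
  · exact absurd (by simpa [gap] using h) (hF a).2
  refine gap_eq_zero (hI.antisymm fun f hf => ?_) hne
  by_contra hfI
  -- If an edge `f` were missing from `I`, adding it would change the trace from `0` to `-t (r(f))`.
  -- By (P) this is positive, as is `t (r(f))`, so `t (r(f)) = 0`, against (F).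
  have h1 := hP a (insert f I) (by
    rw [Finset.coe_insert]
    exact Set.insert_subset hf hI)
  rw [← hcan.map_gap, gap, Finset.sum_insert (by simpa using hfI), add_comm, ← sub_sub,
    map_sub, hcan.map_edge_mul_ghost, ← gap, h, zero_sub] at h1
  exact (hF (E.range f)).2
    (hR.eq_zero_of_add_eq_zero (hF (E.range f)).1 h1 (add_neg_cancel _))

variable [IsScalarTower K R R] [SMulCommClass K R R] [StarModule K R]

theorem IsCanonical.isPos_map_mul_gap_mul_star (hcan : IsCanonical t) (hP : ConditionP t)
    {a : V} {I : Finset D} (hI : (I : Set D) ⊆ E.emitted a) {y : LeavittPathAlgebra K E}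
    (hy : y ∈ pathsTo K E a) : IsPos (t (y * gap K E a I * star y)) := by
  obtain ⟨s, c, -, h⟩ := hcan.exists_map_mul_gap_mul_star hI hy
  rw [h]
  refine IsPos.sum _ fun p _ => IsPos.smul_mul_star _ ?_
  rw [hcan.map_gap]
  exact hP a I hI

/-- Either the trace of the gap is zero, and then so is the gap, or it is a nonzero positive element
and all coefficients of `y` vanish. -/
theorem IsCanonical.mul_gap_eq_zero (hR : IsPosDefStarRing R) (hcan : IsCanonical t)
    (hP : ConditionP t) (hF : ConditionF t) {a : V} {I : Finset D}
    (hI : (I : Set D) ⊆ E.emitted a) {y : LeavittPathAlgebra K E} (hy : y ∈ pathsTo K E a)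
    (h : t (y * gap K E a I * star y) = 0) : y * gap K E a I = 0 := by
  by_cases h0 : t (gap K E a I) = 0
  · rw [hcan.gap_eq_zero_of_map_eq_zero hR hP hF hI h0, mul_zero]
  obtain ⟨s, c, hyc, hc⟩ := hcan.exists_map_mul_gap_mul_star hI hy
  have hpos : IsPos (t (gap K E a I)) := by
    rw [hcan.map_gap]
    exact hP a I hI
  have hz := hR.eq_zero_of_sum_eq_zero s (fun p _ => hpos.smul_mul_star (c p)) (hc.symm.trans h)
  rw [hyc, Finset.sum_eq_zero, zero_mul]
  intro p hp
  rw [hR.eq_zero_of_smul_eq_zero hpos h0 (hz p hp), zero_smul]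

/-- Induction on the length of the ghost paths: right multiplication by `e ∈ I` strips a ghost edge,
and the gap kills the ghost terms. Positivity and definiteness go together, since definiteness needs
the summands to be positive. -/
theorem IsCanonical.isPos_map_mul_star_of_mem_depthLE (hR : IsPosDefStarRing R)
    (hcan : IsCanonical t) (hP : ConditionP t) (hF : ConditionF t) {n : ℕ} {a : V}
    {y : LeavittPathAlgebra K E} (hy : y ∈ depthLE K E n a) :
    IsPos (t (y * star y)) ∧ (t (y * star y) = 0 → y = 0) := by
  induction n generalizing a y with
  | zero =>
    -- At depth zero the empty `I` suffices, its gap being `a`.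
    have hI : ((∅ : Finset D) : Set D) ⊆ E.emitted a := by simp
    have hy1 : y * gap K E a ∅ = y := by
      rw [gap, Finset.sum_empty, sub_zero, mul_vertex_of_mem_pathsTo hy]
    have h1 := hcan.isPos_map_mul_gap_mul_star hP hI hy
    have h2 := hcan.mul_gap_eq_zero hR hP hF hI hy
    rw [hy1] at h1 h2
    exact ⟨h1, h2⟩
  | succ n ih =>
    have hya := mul_vertex_of_mem_depthLE hy
    obtain ⟨x, hx, I, z, hI, hz, hyx⟩ := exists_of_mem_depthLE_succ hy
    have hedge : ∀ e ∈ I, y * edge K E e ∈ depthLE K E n (E.range e) := by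
      intro e he
      obtain rfl : E.source e = a := hI he
      have : y * edge K E e = x * edge K E e + z e := by
        rw [hyx, add_mul, Finset.sum_mul, Finset.sum_eq_single_of_mem e he, mul_assoc,
          ghost_mul_edge_self, mul_vertex_of_mem_depthLE (hz e he)]
        intro f _ hf
        rw [mul_assoc, ghost_mul_edge_of_ne hf, mul_zero]
      rw [this]
      exact add_mem (pathsTo_le_depthLE _ _ (mul_edge_mem_pathsTo hx)) (hz e he)
    have hgap : y * gap K E a I = x * gap K E a I := by
      rw [hyx, add_mul, Finset.sum_mul, Finset.sum_eq_zero, add_zero]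
      intro e he
      rw [mul_assoc, ghost_mul_gap hI he, mul_zero]
    -- As the gap is a projection, `w g w*` depends only on `w g`, so `y` may be replaced by its
    -- ghost-free part `x`.
    have hsq (w : LeavittPathAlgebra K E) :
        w * gap K E a I * star w = (w * gap K E a I) * star (w * gap K E a I) := by
      rw [star_mul, star_gap, ← mul_assoc (w * gap K E a I),
          mul_assoc w (gap K E a I) (gap K E a I), gap_mul_self hI]
    have hdec := mul_star_eq_sum_add I hya
    rw [hsq, hgap, ← hsq] at hdec
    have hpos1 : ∀ e ∈ I, IsPos (t (y * edge K E e * star (y * edge K E e))) :=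
      fun e he => (ih (hedge e he)).1
    have hpos2 := hcan.isPos_map_mul_gap_mul_star hP hI hx
    rw [hdec, map_add, map_sum]
    refine ⟨(IsPos.sum I hpos1).add hpos2, fun h0 => ?_⟩
    have h1 := hR.eq_zero_of_sum_eq_zero I hpos1
      (hR.eq_zero_of_add_eq_zero (IsPos.sum I hpos1) hpos2 h0)
    have h2 := hR.eq_zero_of_add_eq_zero hpos2 (IsPos.sum I hpos1) ((add_comm _ _).trans h0)
    have h3 := hcan.mul_gap_eq_zero hR hP hF hI hx h2
    -- From `y g = 0` follows `y = ∑ y e e*`, and each `y e` is zero by induction.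
    rw [← hgap, gap, mul_sub, hya, sub_eq_zero, Finset.mul_sum] at h3
    rw [h3]
    refine Finset.sum_eq_zero fun e he => ?_
    rw [← mul_assoc, (ih (hedge e he)).2 (h1 e he), zero_mul]

theorem IsCanonical.isPos_map_mul_star (hR : IsPosDefStarRing R) (hcan : IsCanonical t)
    (hP : ConditionP t) (hF : ConditionF t) (x : LeavittPathAlgebra K E) :
    IsPos (t (x * star x)) ∧ (t (x * star x) = 0 → x = 0) := by
  classical
  obtain ⟨s, y, hy, rfl⟩ := exists_sum_depthLE x
  have key (a : V) : IsPos (t (y a * star (y a))) ∧ (t (y a * star (y a)) = 0 → y a = 0) :=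
    hcan.isPos_map_mul_star_of_mem_depthLE hR hP hF (hy a).choose_spec
  have hsum : (∑ a ∈ s, y a) * star (∑ a ∈ s, y a) = ∑ a ∈ s, y a * star (y a) := by
    rw [star_sum, Finset.sum_mul]
    refine Finset.sum_congr rfl fun a ha => ?_
    rw [Finset.mul_sum, Finset.sum_eq_single_of_mem a ha]
    intro b _ hba
    exact mul_star_of_mem_depthLE_of_ne hba.symm (hy a).choose_spec (hy b).choose_spec
  rw [hsum, map_sum]
  refine ⟨IsPos.sum s fun a _ => (key a).1, fun h => Finset.sum_eq_zero fun a ha => ?_⟩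
  exact (key a).2 (hR.eq_zero_of_sum_eq_zero s (fun a _ => (key a).1) h a ha)

theorem IsCanonical.isFaithfulMap (hR : IsPosDefStarRing R) (hcan : IsCanonical t)
    (hP : ConditionP t) (hF : ConditionF t) : IsFaithfulMap t := by
  rintro _ ⟨⟨n, y, rfl⟩, hne⟩
  have key := fun i => hcan.isPos_map_mul_star hR hP hF (y i)
  rw [IsStrictlyPos, map_sum]
  refine ⟨IsPos.sum _ fun i _ => (key i).1, fun h => hne ?_⟩
  refine Finset.sum_eq_zero fun i hi => ?_
  rw [(key i).2 (hR.eq_zero_of_sum_eq_zero _ (fun i _ => (key i).1) h i hi), zero_mul]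

/-! ### From faithfulness to (P) and (F) -/

omit [IsScalarTower K R R] [SMulCommClass K R R] [StarModule K R]

/-- By canonicity the element in (P) is the trace of a gap `g = g g*`. Faithfulness speaks only of
nonzero elements, hence the separate case `g = 0`. -/
theorem IsCanonical.conditionP (hcan : IsCanonical t) (h : IsFaithfulMap t) :
    ConditionP t := by
  intro a I hI
  rw [← hcan.map_gap]
  by_cases h0 : gap K E a I = 0
  · rw [h0, map_zero]
    exact IsPos.zero
  · refine (h _ ⟨?_, h0⟩).1
    rw [← gap_mul_self hI]
    nth_rw 2 [← star_gap]
    exact IsPos.mul_star _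

theorem conditionF_of_isFaithfulMap (h : IsFaithfulMap t) : ConditionF t := by
  refine fun a => h _ ⟨?_, vertex_ne_zero E a⟩
  rw [← vertex_mul_self]
  nth_rw 2 [← star_vertex]
  exact IsPos.mul_star _

end LeavittPathAlgebra

theorem mainTheorem3 {K : Type w} [Field K] [StarRing K]
    {V : Type u} {D : Type v} (E : DirGraph V D)
    {R : Type z} [NonUnitalRing R] [StarRing R] [Module K R] [IsScalarTower K R R]
    [SMulCommClass K R R] [StarModule K R] (hR : IsPosDefStarRing R)
    (t : LeavittPathAlgebra K E →ₗ[K] R) (ht : IsCentralMap t)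
    (hcan : LeavittPathAlgebra.IsCanonical t) :
    IsFaithfulMap t ↔ LeavittPathAlgebra.ConditionP t ∧ LeavittPathAlgebra.ConditionF t :=
  ⟨fun h => ⟨hcan.conditionP h, LeavittPathAlgebra.conditionF_of_isFaithfulMap h⟩,
    fun h => hcan.isFaithfulMap hR h.1 h.2⟩
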